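/- Let $\Sigma$ be a finite alphabet, let $k\ge 1$, and let $\mathcal P(\Sigma^k)$ be the set of probability measures on $\Sigma^k$, with the topology inherited from $\mathbb R^{\Sigma^k}$. A measure $\eta\in\mathcal P(\Sigma^k)$ is shift-invariant if $\sum_{a\in\Sigma}\eta(a\phi)=\sum_{a\in\Sigma}\eta(\phi a)$ for all $\phi\in\Sigma^{k-1}$; let $\mathcal P_{\mathrm{si}}(\Sigma^k)$ be the set of these measures. For a word $\omega$ with $|\omega|\ge k$ let $\mathrm{fr}^k_\omega\in\mathcal P(\Sigma^k)$ be its empirical measure of length-$k$ subwords, $\mathrm{fr}^k_\omega(\phi)=\frac{1}{|\omega|-k+1}\,|\{(\alpha,\gamma)\in\Sigma^*\times\Sigma^*:\alpha\phi\gamma=\omega\}|$. For $\Gamma\subseteq\mathcal P(\Sigma^k)$ (a semiconstrained system) let $$\mathcal B(\Gamma)=\{\omega\in\Sigma^*:|\omega|\ge k,\ \mathrm{fr}^k_\omega\in\Gamma\},\qquad N_m(\Gamma)=\{\omega\in\Sigma^*:\text{every length-}m\text{ subword of }\omega\text{ lies in }\mathcal B(\Gamma)\},$$ and for $S\subseteq\Sigma^*$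 let $\mathrm{cap}(S)=\limsup_{n\to\infty}\frac1n\log_2|S\cap\Sigma^n|\in[-\infty,\infty)$, where $\log_2 0=-\infty$. The set $\Gamma$ is called fat if $\Gamma\cap\mathcal P_{\mathrm{si}}(\Sigma^k)$ and its interior relative to $\mathcal P_{\mathrm{si}}(\Sigma^k)$ have the same closure in $\mathcal P_{\mathrm{si}}(\Sigma^k)$. **Theorem.** Let $\Gamma\subseteq\mathcal P(\Sigma^k)$ be closed, convex and fat. Assume moreover that if $\Gamma$ contains a shift-invariant measure at all, then some shift-invariant measure lies in the interior of $\Gamma$ relative to $\mathcal P(\Sigma^k)$. Then $$\limsup_{m\to\infty}\mathrm{cap}(N_m(\Gamma))=\mathrm{cap}(\mathcal B(\Gamma)).$$ -/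

import Mathlib

open Filter Topology

namespace Semiconstrained

/-- The set `P(A^k)` of probability measures on `A^k`, as vectors indexed by the `k`-tuples. -/
abbrev probMeasures (A : Type*) [Fintype A] (k : ℕ) : Set ((Fin k → A) → ℝ) :=
  stdSimplex ℝ (Fin k → A)

open Classical in
/-- The number of occurrences of the `k`-tuple `φ` as a subword of `w`, that is, the number of
starting positions `i ≤ |w| - k` at which `φ` can be read (used for `k ≤ |w|`). -/
noncomputable def occurrences {A : Type*} {k : ℕ} (w : List A) (φ : Fin k → A) : ℕ :=
  ((Finset.range (w.length - k + 1)).filter fun i => List.ofFn φ <+: w.drop i).card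

/-- The empirical measure `fr_w^k` of the length-`k` subwords of `w` (used for `k ≤ |w|`). -/
noncomputable def freq {A : Type*} (k : ℕ) (w : List A) : (Fin k → A) → ℝ :=
  fun φ => (occurrences w φ : ℝ) / ((w.length : ℝ) - (k : ℝ) + 1)

/-- `B(Γ)`: the admissible words. The measure `fr_w^k` exists only when `k ≤ |w|`. -/
def admissible {A : Type*} {k : ℕ} (Γ : Set ((Fin k → A) → ℝ)) : Set (List A) :=
  {w | k ≤ w.length ∧ freq k w ∈ Γ}

/-- `sub_m(w)`: the set of length-`m` subwords (contiguous blocks) of `w`. -/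
def subwords {A : Type*} (m : ℕ) (w : List A) : Set (List A) :=
  {β | β.length = m ∧ β <:+: w}

/-- `N_m(Γ)`: the words all of whose length-`m` subwords are admissible. -/
def slidingWindow {A : Type*} {k : ℕ} (m : ℕ) (Γ : Set ((Fin k → A) → ℝ)) : Set (List A) :=
  {w | subwords m w ⊆ admissible Γ}

/-- Base-two logarithm of a natural number, with `log₂ 0 = -∞`. -/
noncomputable def log₂ (c : ℕ) : EReal :=
  if c = 0 then ⊥ else ((Real.logb 2 (c : ℝ) : ℝ) : EReal)

/-- `cap(S) = limsup_n (1/n) log₂ |S ∩ A^n|`, a value in `[-∞, ∞]`; it is `-∞` exactly when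
`S` contains words of only finitely many lengths. (For a finite alphabet `S ∩ A^n` is finite.) -/
noncomputable def capacity {A : Type*} (S : Set (List A)) : EReal :=
  limsup (fun n : ℕ =>
    (((1 : ℝ) / (n : ℝ) : ℝ) : EReal) * log₂ {w | w ∈ S ∧ w.length = n}.ncard) atTop

/-- The shift-invariant probability measures on `A^(k+1)`: for every `φ ∈ A^k`, the sum over the
letters `a` of `η(aφ)` equals that of `η(φa)`. -/
def shiftInvariant (A : Type*) [Fintype A] (k : ℕ) : Set ((Fin (k + 1) → A) → ℝ) :=
  {η | η ∈ probMeasures A (k + 1) ∧ ∀ φ : Fin k → A,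
    ∑ a : A, η (Fin.cons a φ : Fin (k + 1) → A) = ∑ a : A, η (Fin.snoc φ a : Fin (k + 1) → A)}

/-- `Γ` is fat: within the space of shift-invariant measures, the interior of the set of
shift-invariant members of `Γ` has the same closure as that set itself. -/
def IsFat {A : Type*} [Fintype A] {k : ℕ} (Γ : Set ((Fin (k + 1) → A) → ℝ)) : Prop :=
  closure (interior {η : shiftInvariant A k | (η : (Fin (k + 1) → A) → ℝ) ∈ Γ}) =
    closure {η : shiftInvariant A k | (η : (Fin (k + 1) → A) → ℝ) ∈ Γ}

end Semiconstrained

/-! Upper bound. Cutting `m` letters off the front of a word of `N_m(Γ)` leaves an admissible word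
and a shorter word of `N_m(Γ)`, so `cap(N_m(Γ))` is at most `(1/m) log₂ |B(Γ) ∩ Σ^m|`.

Lower bound. Concatenated admissible words may have windows with frequencies slightly outside `Γ`,
so they are diluted with a word whose frequencies lie deep inside. Empirical measures are
shift-invariant up to `O(1/n)`, so long admissible words and compactness give a shift-invariant
member of `Γ`; the interior hypothesis then supplies a shift-invariant `η` with room `ε` around it.
`exists_word_near` realizes `η` by a word `u`. A superblock consists of `p|u|` admissible words of
length `n` and then `n` copies of `u`: its frequencies are close to some `(pγ + η)/(p + 1)`, which
by convexity has room `ε/(p + 1)` in `Γ`. With `n` fixed and `m` large, a window of length `m` in a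
concatenation of superblocks is a run of whole superblocks up to short ends, hence admissible. The
free choices give `p/(p + 1)` times the rate of `B(Γ)`, and `p` is arbitrary.

Realizing `η` is a duality argument: for every score `f` on windows some word scores at least the
`η`-mean, so Hahn–Banach puts `η` in a convex hull of count vectors; rounding the weights and
concatenating gives `u`. -/

namespace Semiconstrained

/-! ### Counting windows of length `k + 1`: near-additivity and near-shift-invariance. -/

section Counting

variable {A : Type*} {k : ℕ}

open Classical in
/-- The number of positions at which the tuple `φ` can be read in a word, by recursion. -/
noncomputable def windowCount (φ : Fin (k + 1) → A) : List A → ℕ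
  | [] => 0
  | a :: w => (if List.ofFn φ <+: a :: w then 1 else 0) + windowCount φ w

open Classical in
theorem windowCount_eq_sum (φ : Fin (k + 1) → A) (w : List A) :
    windowCount φ w =
      ∑ i ∈ Finset.range w.length, if List.ofFn φ <+: w.drop i then 1 else 0 := by
  induction w with
  | nil => simp [windowCount]
  | cons a w ih =>
    rw [windowCount, List.length_cons, Finset.sum_range_succ', ih, add_comm]
    simp

/-- The two ranges of starting positions differ only where fewer than `k + 1` letters remain, also
when the truncated subtraction gives zero. -/
theorem occurrences_eq_windowCount (w : List A) (φ : Fin (k + 1) → A) :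
    occurrences w φ = windowCount φ w := by
  classical
  rw [windowCount_eq_sum, ← Finset.card_filter, occurrences]
  congr 1
  ext i
  simp only [Finset.mem_filter, Finset.mem_range, and_congr_left_iff]
  intro h
  have := h.length_le
  simp only [List.length_ofFn, List.length_drop] at this
  omega

theorem windowCount_le_length (φ : Fin (k + 1) → A) (w : List A) :
    windowCount φ w ≤ w.length := by
  induction w with
  | nil => simp [windowCount]
  | cons a w ih =>
    rw [windowCount, List.length_cons]
    split_ifs <;> omega

theorem add_le_windowCount_append (φ : Fin (k + 1) → A) (u v : List A) :
    windowCount φ u + windowCount φ v ≤ windowCount φ (u ++ v) := by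
  induction u with
  | nil => simp [windowCount]
  | cons a u ih =>
    rw [List.cons_append, windowCount, windowCount]
    by_cases h : List.ofFn φ <+: a :: u
    · have h' : List.ofFn φ <+: a :: (u ++ v) := h.trans (List.prefix_append (a :: u) v)
      rw [if_pos h, if_pos h']
      omega
    · rw [if_neg h]
      omega

open Classical in
-- An occurrence straddling the junction starts among the last `k` letters of `u`. The `min`, in
-- place of `k`, makes the induction on `u` close.
theorem windowCount_append_le_add_min (φ : Fin (k + 1) → A) (u v : List A) :
    windowCount φ (u ++ v) ≤ windowCount φ u + windowCount φ v + min k u.length := by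
  induction u with
  | nil => simp [windowCount]
  | cons a u ih =>
    rw [List.cons_append, windowCount, windowCount, List.length_cons]
    by_cases hl : k + 1 ≤ u.length + 1
    · have hiff : List.ofFn φ <+: a :: (u ++ v) ↔ List.ofFn φ <+: a :: u := by
        constructor
        · intro h
          exact List.prefix_of_prefix_length_le h (List.prefix_append (a :: u) v) (by simpa using hl)
        · intro h
          exact h.trans (List.prefix_append (a :: u) v)
      rw [if_congr hiff rfl rfl]
      have : min k u.length ≤ min k (u.length + 1) := by omega
      omega
    · have : min k (u.length + 1) = min k u.length + 1 := by omega
      rw [this]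
      split_ifs <;> omega

theorem windowCount_append_le (φ : Fin (k + 1) → A) (u v : List A) :
    windowCount φ (u ++ v) ≤ windowCount φ u + windowCount φ v + k :=
  (windowCount_append_le_add_min φ u v).trans (by omega)

open Classical in
theorem sum_ofFn_prefix [Fintype A] {n : ℕ} (f : (Fin n → A) → ℝ) (ψ : Fin n → A) {w : List A}
    (h : List.ofFn ψ <+: w) :
    ∑ φ, f φ * (if List.ofFn φ <+: w then 1 else 0) = f ψ := by
  rw [Finset.sum_eq_single ψ]
  · simp [h]
  · intro φ _ hne
    rw [if_neg, mul_zero]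
    intro h'
    apply hne
    apply List.ofFn_injective
    exact (List.prefix_of_prefix_length_le h' h (by simp)).eq_of_length (by simp)
  · simp

theorem exists_ofFn_prefix {n : ℕ} {w : List A} (h : n ≤ w.length) :
    ∃ ψ : Fin n → A, List.ofFn ψ <+: w := by
  refine ⟨fun i => w[i]'(by omega), ?_⟩
  have : List.ofFn (fun i : Fin n => w[i]'(by omega)) = w.take n := by
    apply List.ext_getElem
    · simp [h]
    · intro i h1 h2
      simp
  rw [this]
  exact List.take_prefix n w

/-- The vector of all window counts of a word. -/
noncomputable def countVec (k : ℕ) (w : List A) : (Fin (k + 1) → A) → ℝ :=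
  fun φ => windowCount φ w

theorem freq_eq (w : List A) :
    freq (k + 1) w = ((w.length : ℝ) - k)⁻¹ • countVec k w := by
  ext φ
  simp only [freq, occurrences_eq_windowCount, Pi.smul_apply, countVec, smul_eq_mul]
  rw [div_eq_inv_mul]
  congr 2
  push_cast
  ring

theorem countVec_nil : countVec k ([] : List A) = 0 := by
  ext φ
  simp [countVec, windowCount]

variable [Fintype A]

theorem sum_mul_countVec_cons (f : (Fin (k + 1) → A) → ℝ) (ψ : Fin (k + 1) → A) {a : A}
    {w : List A} (h : List.ofFn ψ <+: a :: w) :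
    ∑ φ, f φ * countVec k (a :: w) φ = f ψ + ∑ φ, f φ * countVec k w φ := by
  classical
  rw [← sum_ofFn_prefix f ψ h, ← Finset.sum_add_distrib]
  refine Finset.sum_congr rfl fun φ _ => ?_
  simp only [countVec, windowCount]
  push_cast
  ring

omit [Fintype A] in
theorem windowCount_eq_zero (φ : Fin (k + 1) → A) (w : List A) (h : w.length ≤ k) :
    windowCount φ w = 0 := by
  induction w with
  | nil => rfl
  | cons a w ih =>
    rw [windowCount, if_neg, ih]
    · simp at h; omega
    · intro hp
      have := hp.length_le
      simp at this h
      omega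

theorem sum_countVec (w : List A) (h : k ≤ w.length) :
    ∑ φ, countVec k w φ = (w.length : ℝ) - k := by
  induction w with
  | nil =>
    simp only [List.length_nil, nonpos_iff_eq_zero] at h
    subst h
    simp [countVec_nil]
  | cons a w ih =>
    by_cases hk : k ≤ w.length
    · obtain ⟨ψ, hψ⟩ := exists_ofFn_prefix (n := k + 1) (w := a :: w) (by simpa using hk)
      have := sum_mul_countVec_cons (fun _ => (1 : ℝ)) ψ hψ
      simp only [one_mul] at this
      rw [this, ih hk, List.length_cons]
      push_cast
      ring
    · have hk' : (a :: w).length = k := by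
        simp only [List.length_cons] at h ⊢
        omega
      rw [hk', sub_self]
      refine Finset.sum_eq_zero fun φ _ => ?_
      simp [countVec, windowCount_eq_zero φ (a :: w) hk'.le]

theorem norm_countVec_append_sub_le (u v : List A) :
    ‖countVec k (u ++ v) - (countVec k u + countVec k v)‖ ≤ k := by
  refine (pi_norm_le_iff_of_nonneg (Nat.cast_nonneg k)).2 fun φ => ?_
  have h1 : ((windowCount φ u + windowCount φ v : ℕ) : ℝ) ≤ windowCount φ (u ++ v) := by
    exact_mod_cast add_le_windowCount_append φ u v
  have h2 : (windowCount φ (u ++ v) : ℝ) ≤ ((windowCount φ u + windowCount φ v + k : ℕ) : ℝ) := by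
    exact_mod_cast windowCount_append_le φ u v
  push_cast at h1 h2
  rw [Real.norm_eq_abs, abs_le]
  simp only [Pi.sub_apply, Pi.add_apply, countVec]
  constructor <;> linarith

open Classical in
theorem sum_prefix_snoc (φ : Fin k → A) (w : List A) :
    ∑ a : A, (if List.ofFn (Fin.snoc φ a : Fin (k + 1) → A) <+: w then 1 else 0) =
      if List.ofFn φ <+: w ∧ List.ofFn φ ≠ w then 1 else 0 := by
  simp only [List.ofFn_succ', Fin.snoc_castSucc, Fin.snoc_last, List.concat_eq_append]
  split_ifs with h
  · obtain ⟨⟨t, ht⟩, hne⟩ := h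
    cases t with
    | nil => simp at ht; exact absurd ht hne
    | cons b t =>
      rw [Finset.sum_eq_single b]
      · rw [if_pos]
        exact ⟨t, by simpa using ht⟩
      · intro a _ hab
        rw [if_neg]
        rintro ⟨t', ht'⟩
        rw [← ht] at ht'
        simp at ht'
        exact hab ht'.1
      · simp
  · refine Finset.sum_eq_zero fun a _ => if_neg fun hp => h ⟨(List.prefix_append _ _).trans hp, ?_⟩
    rintro rfl
    have := hp.length_le
    simp at this

open Classical in
-- An occurrence of `φ` extends to the left unless it is a prefix and to the right unless it is a
-- suffix; both sides count all occurrences of `φ`, up to the same two corrections.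
theorem sum_windowCount_cons_add (φ : Fin k → A) (w : List A) :
    (∑ a : A, windowCount (Fin.cons a φ : Fin (k + 1) → A) w) +
        (if List.ofFn φ <+: w then 1 else 0) =
      (∑ a : A, windowCount (Fin.snoc φ a : Fin (k + 1) → A) w) +
        (if List.ofFn φ <:+ w then 1 else 0) := by
  induction w with
  | nil => simp [windowCount]
  | cons b w ih =>
    simp only [windowCount, Finset.sum_add_distrib, sum_prefix_snoc]
    have hcons : ∑ a : A, (if List.ofFn (Fin.cons a φ : Fin (k + 1) → A) <+: b :: w then 1 else 0)
        = if List.ofFn φ <+: w then 1 else 0 := by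
      simp only [List.ofFn_succ, Fin.cons_zero, Fin.cons_succ, List.cons_prefix_cons]
      rw [Finset.sum_eq_single b]
      · simp
      · intro a _ hab
        simp [hab]
      · simp
    rw [hcons]
    have key : (if List.ofFn φ <:+ w then 1 else 0) + (if List.ofFn φ <+: b :: w then 1 else 0) =
        (if List.ofFn φ <+: b :: w ∧ List.ofFn φ ≠ b :: w then 1 else 0) +
          (if List.ofFn φ <:+ b :: w then 1 else 0) := by
      rw [if_congr List.suffix_cons_iff rfl rfl]
      by_cases he : List.ofFn φ = b :: w
      · have : ¬ (b :: w <:+ w) := fun h => by simpa using h.length_le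
        simp [he, this]
      · simp [he, add_comm]
    omega

theorem abs_sum_countVec_cons_sub_le (φ : Fin k → A) (w : List A) :
    |∑ a : A, countVec k w (Fin.cons a φ) - ∑ a : A, countVec k w (Fin.snoc φ a)| ≤ 1 := by
  classical
  have h := sum_windowCount_cons_add φ w
  have h' := congrArg (Nat.cast : ℕ → ℝ) h
  push_cast at h'
  simp only [countVec]
  rw [abs_le]
  split_ifs at h' <;> constructor <;> linarith

end Counting

end Semiconstrained

namespace Semiconstrained

/-! ### Realizing shift-invariant measures by words. -/

section Realization

variable {A : Type*} [Fintype A] {k : ℕ}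

theorem sum_eq_sum_snoc (g : (Fin (k + 1) → A) → ℝ) :
    ∑ ψ, g ψ = ∑ φ : Fin k → A, ∑ a : A, g (Fin.snoc φ a) := by
  rw [← (Fin.snocEquiv fun _ => A).sum_comp, Fintype.sum_prod_type, Finset.sum_comm]
  rfl

theorem sum_eq_sum_cons (g : (Fin (k + 1) → A) → ℝ) :
    ∑ ψ, g ψ = ∑ φ : Fin k → A, ∑ a : A, g (Fin.cons a φ) := by
  rw [← (Fin.consEquiv fun _ => A).sum_comp, Fintype.sum_prod_type, Finset.sum_comm]
  rfl

theorem nonempty_of_mem_probMeasures {η : (Fin (k + 1) → A) → ℝ}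
    (hη : η ∈ probMeasures A (k + 1)) : Nonempty A := by
  by_contra h
  rw [not_nonempty_iff] at h
  have := hη.2
  simp at this

/-- A potential whose values are attained by words, and whose mean dominates that of `f`. -/
theorem exists_potential {η : (Fin (k + 1) → A) → ℝ} (hη : η ∈ shiftInvariant A k)
    (f : (Fin (k + 1) → A) → ℝ) (n : ℕ) :
    ∃ V : (Fin k → A) → ℝ,
      (∀ φ, ∃ w : List A, w.length = n + k ∧ List.ofFn φ <+: w ∧
        V φ = ∑ ψ, f ψ * countVec k w ψ) ∧
      n * ∑ ψ, f ψ * η ψ ≤ ∑ φ : Fin k → A, ∑ a : A, η (Fin.snoc φ a) * V φ := by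
  have := nonempty_of_mem_probMeasures hη.1
  induction n with
  | zero =>
    refine ⟨0, fun φ => ⟨List.ofFn φ, by simp, List.prefix_rfl, ?_⟩, by simp⟩
    symm
    refine Finset.sum_eq_zero fun ψ _ => ?_
    simp [countVec, windowCount_eq_zero ψ (List.ofFn φ) (by simp)]
  | succ n ih =>
    obtain ⟨V, hV, hsum⟩ := ih
    -- Dynamic programming: `g ψ` is the score of reading `ψ` and continuing from its last `k`
    -- letters; the new potential maximizes over the letter following `φ`.
    let g : (Fin (k + 1) → A) → ℝ := fun ψ => f ψ + V (Fin.tail ψ)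
    choose best hbest using fun φ : Fin k → A =>
      Finite.exists_max fun a : A => g (Fin.snoc φ a)
    refine ⟨fun φ => g (Fin.snoc φ (best φ)), fun φ => ?_, ?_⟩
    · obtain ⟨ψ, hψ⟩ : ∃ ψ : Fin (k + 1) → A, ψ = Fin.snoc φ (best φ) := ⟨_, rfl⟩
      obtain ⟨w, hw, hp, hVw⟩ := hV (Fin.tail ψ)
      have hψw : List.ofFn ψ <+: ψ 0 :: w := by
        rw [List.ofFn_succ]
        exact (List.prefix_cons_inj _).2 hp
      refine ⟨ψ 0 :: w, by simp [hw]; omega, ?_, ?_⟩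
      · refine List.IsPrefix.trans ?_ hψw
        rw [hψ, List.ofFn_succ']
        simp [List.concat_eq_append]
      · rw [sum_mul_countVec_cons f ψ hψw, ← hVw, hψ]
    · have h1 : ∑ ψ, η ψ * g ψ ≤
          ∑ φ : Fin k → A, ∑ a : A, η (Fin.snoc φ a) * g (Fin.snoc φ (best φ)) := by
        rw [sum_eq_sum_snoc]
        exact Finset.sum_le_sum fun φ _ => Finset.sum_le_sum fun a _ =>
          mul_le_mul_of_nonneg_left (hbest φ a) (hη.1.1 _)
      -- Shift-invariance enters here: under `η` the last `k` letters of a window have the same law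
      -- as the first `k`.
      have h2 : ∑ ψ, η ψ * V (Fin.tail ψ) =
          ∑ φ : Fin k → A, ∑ a : A, η (Fin.snoc φ a) * V φ := by
        rw [sum_eq_sum_cons]
        refine Finset.sum_congr rfl fun φ _ => ?_
        simp only [Fin.tail_cons, ← Finset.sum_mul]
        rw [hη.2 φ]
      refine le_trans ?_ h1
      simp only [g, mul_add, Finset.sum_add_distrib, h2]
      have h3 : ∑ ψ, η ψ * f ψ = ∑ ψ, f ψ * η ψ :=
        Finset.sum_congr rfl fun ψ _ => mul_comm _ _
      rw [h3]
      push_cast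
      linarith

/-- Some value of the potential reaches its mean, and every value is the score of a word. -/
theorem exists_word_le {η : (Fin (k + 1) → A) → ℝ} (hη : η ∈ shiftInvariant A k)
    (f : (Fin (k + 1) → A) → ℝ) (n : ℕ) :
    ∃ w : List A, w.length = n + k ∧
      n * ∑ ψ, f ψ * η ψ ≤ ∑ ψ, f ψ * countVec k w ψ := by
  obtain ⟨V, hV, hsum⟩ := exists_potential hη f n
  by_contra! hlt
  have hVlt : ∀ φ, V φ < n * ∑ ψ, f ψ * η ψ := by
    intro φ
    obtain ⟨w, hw, -, hVw⟩ := hV φ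
    rw [hVw]
    exact hlt w hw
  have hone : ∑ φ : Fin k → A, ∑ a : A, η (Fin.snoc φ a) = 1 := by
    rw [← sum_eq_sum_snoc, hη.1.2]
  have : ∑ φ : Fin k → A, ∑ a : A, η (Fin.snoc φ a) * V φ < n * ∑ ψ, f ψ * η ψ := by
    calc ∑ φ : Fin k → A, ∑ a : A, η (Fin.snoc φ a) * V φ
        = ∑ φ : Fin k → A, (∑ a : A, η (Fin.snoc φ a)) * V φ := by simp only [Finset.sum_mul]
      _ < ∑ φ : Fin k → A, (∑ a : A, η (Fin.snoc φ a)) * (n * ∑ ψ, f ψ * η ψ) := by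
          have hnn : ∀ φ : Fin k → A, 0 ≤ ∑ a : A, η (Fin.snoc φ a) :=
            fun φ => Finset.sum_nonneg fun a _ => hη.1.1 _
          obtain ⟨φ, -, hφ⟩ := Finset.exists_ne_zero_of_sum_ne_zero (hone.trans_ne one_ne_zero)
          refine Finset.sum_lt_sum
            (fun φ _ => mul_le_mul_of_nonneg_left (hVlt φ).le (hnn φ)) ⟨φ, Finset.mem_univ φ, ?_⟩
          exact mul_lt_mul_of_pos_left (hVlt φ) (lt_of_le_of_ne (hnn φ) hφ.symm)
      _ = n * ∑ ψ, f ψ * η ψ := by rw [← Finset.sum_mul, hone, one_mul]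
  linarith

/-- A shift-invariant measure is a convex combination of count vectors of words of a given
length. -/
theorem mem_convexHull_countVec {η : (Fin (k + 1) → A) → ℝ} (hη : η ∈ shiftInvariant A k)
    (n : ℕ) :
    (n : ℝ) • η ∈ convexHull ℝ (countVec k '' {w : List A | w.length = n + k}) := by
  by_contra hnot
  have hclosed : IsClosed (convexHull ℝ (countVec k '' {w : List A | w.length = n + k})) :=
    ((List.finite_length_eq A (n + k)).image _).isClosed_convexHull ℝ
  obtain ⟨F, u, hF, hu⟩ := geometric_hahn_banach_closed_point (convex_convexHull ℝ _) hclosed hnot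
  classical
  have hrep : ∀ x, F x = ∑ ψ, F (Pi.single ψ 1) * x ψ := by
    intro x
    conv_lhs => rw [pi_eq_sum_univ' x]
    simp [map_sum, mul_comm]
  obtain ⟨w, hw, hle⟩ := exists_word_le hη (fun ψ => F (Pi.single ψ 1)) n
  rw [← hrep, ← hrep] at hle
  have h1 := hF _ (subset_convexHull ℝ _ ⟨w, hw, rfl⟩)
  rw [map_smul, smul_eq_mul] at hu
  linarith

theorem norm_countVec_le (w : List A) : ‖countVec k w‖ ≤ w.length := by
  refine (pi_norm_le_iff_of_nonneg (Nat.cast_nonneg _)).2 fun φ => ?_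
  rw [Real.norm_eq_abs, countVec, abs_of_nonneg (Nat.cast_nonneg _)]
  exact_mod_cast windowCount_le_length φ w

theorem norm_countVec_flatten_sub_le (L : List (List A)) :
    ‖countVec k L.flatten - (L.map (countVec k)).sum‖ ≤ L.length * k := by
  induction L with
  | nil => simp [countVec_nil]
  | cons w L ih =>
    have h := norm_countVec_append_sub_le (k := k) w L.flatten
    rw [List.flatten_cons, List.map_cons, List.sum_cons, List.length_cons]
    calc ‖countVec k (w ++ L.flatten) - (countVec k w + (L.map (countVec k)).sum)‖
        = ‖(countVec k (w ++ L.flatten) - (countVec k w + countVec k L.flatten)) +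
            (countVec k L.flatten - (L.map (countVec k)).sum)‖ := by congr 1; abel
      _ ≤ k + L.length * k := (norm_add_le _ _).trans (add_le_add h ih)
      _ = ((L.length + 1 : ℕ) : ℝ) * k := by push_cast; ring

theorem norm_le_one_of_mem_probMeasures {n : ℕ} {η : (Fin n → A) → ℝ}
    (hη : η ∈ probMeasures A n) : ‖η‖ ≤ 1 := by
  refine (pi_norm_le_iff_of_nonneg zero_le_one).2 fun φ => ?_
  rw [Real.norm_eq_abs, abs_of_nonneg (hη.1 φ), ← hη.2]
  exact Finset.single_le_sum (fun ψ _ => hη.1 ψ) (Finset.mem_univ φ)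

omit [Fintype A] in
theorem sum_map_flatMap_replicate {ι : Type*} [Fintype ι] {B : Type*} [AddCommMonoid B]
    (q : ι → ℕ) (z : ι → List A) (g : List A → B) :
    ((Finset.univ.toList.flatMap fun i => List.replicate (q i) (z i)).map g).sum =
      ∑ i, q i • g (z i) := by
  rw [← Finset.sum_map_toList]
  induction (Finset.univ : Finset ι).toList with
  | nil => simp
  | cons i l ih => simp [ih]

/-- Every shift-invariant measure is approximated by empirical measures of words. -/
theorem exists_word_near {η : (Fin (k + 1) → A) → ℝ} (hη : η ∈ shiftInvariant A k)
    {e : ℝ} (he : 0 < e) :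
    ∃ u : List A, 0 < u.length ∧ k ≤ e * u.length ∧
      ‖countVec k u - (u.length : ℝ) • η‖ ≤ e * u.length := by
  obtain ⟨n, hn⟩ := exists_nat_ge (4 * k / e)
  have hnk : 4 * (k : ℝ) ≤ e * n := by rwa [div_le_iff₀' he] at hn
  obtain ⟨ι, _, p, z, hp0, hp1, hz, hpz⟩ :=
    mem_convexHull_iff_exists_fintype.1 (mem_convexHull_countVec hη (n + 1))
  choose w hw hwz using hz
  set l : ℝ := (n : ℝ) + 1 + k with hl
  have hlen : ∀ i, ((w i).length : ℝ) = l := by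
    intro i
    have : (w i).length = n + 1 + k := hw i
    rw [this]
    push_cast
    ring
  set c : ℝ := (Fintype.card ι : ℝ) with hc
  have hc0 : 0 ≤ c := Nat.cast_nonneg _
  -- The weights are rounded down to multiples of `1 / Q`. The `c` rounding errors, at most one copy
  -- of a word each, must be small against the total number `qs` of copies.
  obtain ⟨Q, hQ⟩ := exists_nat_ge (c + 1 + 4 * c / e)
  let q : ι → ℕ := fun i => ⌊p i * Q⌋₊
  set qs : ℝ := ∑ i, (q i : ℝ) with hqs
  have hdiff : ∀ i, |(q i : ℝ) - p i * Q| ≤ 1 := by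
    intro i
    have h1 := Nat.floor_le (mul_nonneg (hp0 i) (Nat.cast_nonneg Q))
    have h2 := Nat.lt_floor_add_one (p i * Q)
    rw [abs_le]
    constructor <;> simp only [q] <;> linarith
  have hqsQ : |qs - Q| ≤ c := by
    have : qs - Q = ∑ i, ((q i : ℝ) - p i * Q) := by
      rw [Finset.sum_sub_distrib, ← Finset.sum_mul, hp1, one_mul]
    rw [this]
    refine (Finset.abs_sum_le_sum_abs _ _).trans ((Finset.sum_le_sum fun i _ => hdiff i).trans ?_)
    simp [hc]
  have hqs1 : 1 + 4 * c / e ≤ qs := by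
    have := (abs_le.1 hqsQ).1
    linarith
  have h4c : 4 * c ≤ e * qs := by
    have : 4 * c / e ≤ qs := by linarith
    rwa [div_le_iff₀' he] at this
  have hqs_one : 1 ≤ qs := by
    have : 0 ≤ 4 * c / e := by positivity
    linarith
  let L : List (List A) := Finset.univ.toList.flatMap fun i => List.replicate (q i) (w i)
  have hLlen : (L.length : ℝ) = qs := by
    have := sum_map_flatMap_replicate q w (fun _ => (1 : ℕ))
    change (L.map _).sum = _ at this
    simp only [List.map_const', List.sum_replicate, smul_eq_mul, mul_one] at this
    rw [this]
    push_cast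
    rfl
  have hulen : (L.flatten.length : ℝ) = qs * l := by
    rw [List.length_flatten, sum_map_flatMap_replicate]
    push_cast
    simp only [smul_eq_mul, Nat.cast_mul, hlen, ← Finset.sum_mul, hqs]
  have hl0 : 0 < l := by positivity
  have hk4 : 4 * (k : ℝ) ≤ e * l := by
    have : e * n ≤ e * l := mul_le_mul_of_nonneg_left (by rw [hl]; linarith [Nat.cast_nonneg (α := ℝ) k]) he.le
    linarith
  have hel : e * l ≤ e * (qs * l) :=
    mul_le_mul_of_nonneg_left (le_mul_of_one_le_left hl0.le hqs_one) he.le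
  refine ⟨L.flatten, ?_, ?_, ?_⟩
  · have : (0 : ℝ) < L.flatten.length := by rw [hulen]; positivity
    exact_mod_cast this
  · rw [hulen]
    linarith [Nat.cast_nonneg (α := ℝ) k]
  · have h1 := norm_countVec_flatten_sub_le (k := k) L
    rw [hLlen, sum_map_flatMap_replicate] at h1
    have hη1 := norm_le_one_of_mem_probMeasures hη.1
    have h2 : ‖∑ i, ((q i : ℝ) - p i * Q) • countVec k (w i)‖ ≤ c * l := by
      refine (norm_sum_le _ _).trans ?_
      have : ∀ i ∈ (Finset.univ : Finset ι), ‖((q i : ℝ) - p i * Q) • countVec k (w i)‖ ≤ l := by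
        intro i _
        rw [norm_smul, Real.norm_eq_abs]
        refine (mul_le_mul (hdiff i) (norm_countVec_le _) (norm_nonneg _) zero_le_one).trans ?_
        rw [hlen, one_mul]
      refine (Finset.sum_le_sum this).trans ?_
      simp [hc]
    have h3 : ‖((Q : ℝ) - qs) • (((n : ℝ) + 1) • η)‖ ≤ c * l := by
      rw [norm_smul, norm_smul, Real.norm_eq_abs, abs_sub_comm, Real.norm_eq_abs,
        abs_of_nonneg (by positivity : (0 : ℝ) ≤ n + 1)]
      refine mul_le_mul hqsQ ?_ (by positivity) hc0
      refine (mul_le_of_le_one_right (by positivity) hη1).trans ?_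
      rw [hl]
      linarith [Nat.cast_nonneg (α := ℝ) k]
    have h4 : ‖(qs * k) • η‖ ≤ qs * k := by
      rw [norm_smul, Real.norm_eq_abs, abs_of_nonneg (by positivity)]
      exact mul_le_of_le_one_right (by positivity) hη1
    have hsum : ∑ i, (p i * Q) • countVec k (w i) = (Q : ℝ) • (((n : ℝ) + 1) • η) := by
      have : ((n : ℝ) + 1) • η = ∑ i, p i • countVec k (w i) := by
        simp only [hwz]
        rw [hpz]
        push_cast
        rfl
      rw [this, Finset.smul_sum]
      refine Finset.sum_congr rfl fun i _ => ?_
      rw [smul_smul, mul_comm]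
    -- Four errors, each at most a quarter of the allowance: the junctions, the rounding of the
    -- weights, the rounding of their total, and the `k` letters of each word beyond its `n + 1`
    -- windows.
    have hdecomp : countVec k L.flatten - (L.flatten.length : ℝ) • η =
        (countVec k L.flatten - ∑ i, q i • countVec k (w i)) +
          ∑ i, ((q i : ℝ) - p i * Q) • countVec k (w i) +
          ((Q : ℝ) - qs) • (((n : ℝ) + 1) • η) - (qs * k) • η := by
      have : ∑ i, ((q i : ℝ) - p i * Q) • countVec k (w i) =
          ∑ i, q i • countVec k (w i) - (Q : ℝ) • (((n : ℝ) + 1) • η) := by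
        simp only [sub_smul, Finset.sum_sub_distrib, hsum, Nat.cast_smul_eq_nsmul]
      rw [this, hulen, hl]
      module
    rw [hdecomp, hulen]
    have h5 : 4 * c * l ≤ e * qs * l := mul_le_mul_of_nonneg_right h4c hl0.le
    have h6 : 4 * (k : ℝ) * qs ≤ e * l * qs := mul_le_mul_of_nonneg_right hk4 (by linarith)
    calc _ ≤ qs * k + c * l + c * l + qs * k := by
          refine (norm_sub_le _ _).trans (add_le_add ?_ h4)
          refine (norm_add_le _ _).trans (add_le_add ?_ h3)
          exact (norm_add_le _ _).trans (add_le_add h1 h2)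
      _ ≤ e * (qs * l) := by nlinarith

end Realization

end Semiconstrained

namespace Semiconstrained

/-! ### Capacities, the upper bound, and shift-invariant limits of admissible words. -/

section Capacity

variable {A : Type*}

/-- The words of length `n` in a set of words. -/
def slice (S : Set (List A)) (n : ℕ) : Set (List A) :=
  {w | w ∈ S ∧ w.length = n}

theorem capacity_eq (S : Set (List A)) :
    capacity S = limsup (fun n : ℕ =>
      (((1 : ℝ) / (n : ℝ) : ℝ) : EReal) * log₂ (slice S n).ncard) atTop :=
  rfl

theorem inv_mul_log₂_le_iff {n : ℕ} (hn : 0 < n) (a : ℕ) (x : ℝ) :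
    (((1 : ℝ) / (n : ℝ) : ℝ) : EReal) * log₂ a ≤ x ↔ (a : ℝ) ≤ 2 ^ (x * n) := by
  have hn' : (0 : ℝ) < n := Nat.cast_pos.2 hn
  rcases Nat.eq_zero_or_pos a with rfl | ha
  · rw [log₂, if_pos rfl, EReal.coe_mul_bot_of_pos (by positivity)]
    simp only [bot_le, Nat.cast_zero, true_iff]
    positivity
  · rw [log₂, if_neg ha.ne', ← EReal.coe_mul, EReal.coe_le_coe_iff, one_div,
      inv_mul_le_iff₀ hn', mul_comm, Real.logb_le_iff_le_rpow one_lt_two (Nat.cast_pos.2 ha)]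

theorem le_inv_mul_log₂_iff {n : ℕ} (hn : 0 < n) (a : ℕ) (x : ℝ) :
    (x : EReal) ≤ (((1 : ℝ) / (n : ℝ) : ℝ) : EReal) * log₂ a ↔ (2 : ℝ) ^ (x * n) ≤ a := by
  have hn' : (0 : ℝ) < n := Nat.cast_pos.2 hn
  rcases Nat.eq_zero_or_pos a with rfl | ha
  · rw [log₂, if_pos rfl, EReal.coe_mul_bot_of_pos (by positivity)]
    have : (0 : ℝ) < 2 ^ (x * n) := by positivity
    simp [this]
  · rw [log₂, if_neg ha.ne', ← EReal.coe_mul, EReal.coe_le_coe_iff, one_div,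
      le_inv_mul_iff₀ hn', mul_comm, Real.le_logb_iff_rpow_le one_lt_two (Nat.cast_pos.2 ha)]

theorem capacity_le {S : Set (List A)} {c C : ℝ} (hC : 0 < C)
    (h : ∀ n, ((slice S n).ncard : ℝ) ≤ C * 2 ^ (c * n)) : capacity S ≤ c := by
  have hlim : Tendsto (fun n : ℕ => ((c + Real.logb 2 C / n : ℝ) : EReal)) atTop (𝓝 (c : EReal)) := by
    refine (continuous_coe_real_ereal.tendsto c).comp ?_
    simpa using tendsto_const_nhds.add (tendsto_const_div_atTop_nhds_zero_nat (Real.logb 2 C))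
  rw [capacity_eq, ← hlim.limsup_eq]
  refine limsup_le_limsup ?_
  filter_upwards [eventually_gt_atTop 0] with n hn
  have hn' : (n : ℝ) ≠ 0 := by positivity
  rw [inv_mul_log₂_le_iff hn, add_mul, div_mul_cancel₀ _ hn', Real.rpow_add two_pos,
    Real.rpow_logb two_pos (by norm_num) hC, mul_comm]
  exact h n

theorem le_capacity {S : Set (List A)} {c : ℝ}
    (h : ∃ᶠ n : ℕ in atTop, (2 : ℝ) ^ (c * n) ≤ (slice S n).ncard) : (c : EReal) ≤ capacity S := by
  rw [capacity_eq]
  refine le_limsup_of_frequently_le' ((h.and_eventually (eventually_gt_atTop 0)).mono ?_)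
  rintro n ⟨h1, hn⟩
  exact (le_inv_mul_log₂_iff hn _ _).2 h1

theorem frequently_lt_ncard_slice {S : Set (List A)} {c : ℝ} (h : (c : EReal) < capacity S) :
    ∃ᶠ n : ℕ in atTop, (2 : ℝ) ^ (c * n) < (slice S n).ncard := by
  rw [capacity_eq] at h
  refine ((frequently_lt_of_lt_limsup (by isBoundedDefault) h).and_eventually
    (eventually_gt_atTop 0)).mono ?_
  rintro n ⟨h1, hn⟩
  rw [← not_le] at h1 ⊢
  rwa [inv_mul_log₂_le_iff hn] at h1

theorem eventually_ncard_slice_le {S : Set (List A)} {c : ℝ} (h : capacity S < c) :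
    ∀ᶠ n : ℕ in atTop, ((slice S n).ncard : ℝ) ≤ 2 ^ (c * n) := by
  rw [capacity_eq] at h
  filter_upwards [eventually_lt_of_limsup_lt h, eventually_gt_atTop 0] with n h1 hn
  exact (inv_mul_log₂_le_iff hn _ _).1 h1.le

theorem slidingWindow_of_infix {k m : ℕ} {Γ : Set ((Fin k → A) → ℝ)} {v w : List A}
    (hw : w ∈ slidingWindow m Γ) (h : v <:+: w) : v ∈ slidingWindow m Γ :=
  fun _ hv => hw ⟨hv.1, hv.2.trans h⟩

variable [Fintype A]

theorem finite_slice (S : Set (List A)) (n : ℕ) : (slice S n).Finite :=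
  (List.finite_length_eq A n).subset fun _ hw => hw.2

theorem ncard_slice_slidingWindow_le {k m n : ℕ} (Γ : Set ((Fin k → A) → ℝ)) (h : m ≤ n) :
    (slice (slidingWindow m Γ) n).ncard ≤
      (slice (admissible Γ) m).ncard * (slice (slidingWindow m Γ) (n - m)).ncard := by
  have hfin := (finite_slice (admissible Γ) m).prod (finite_slice (slidingWindow m Γ) (n - m))
  rw [← Set.ncard_prod]
  refine (Set.ncard_le_ncard ?_ (hfin.image fun p => p.1 ++ p.2)).trans (Set.ncard_image_le hfin)
  rintro w ⟨hw, hwn⟩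
  refine ⟨(w.take m, w.drop m), ⟨⟨hw ⟨?_, ?_⟩, ?_⟩, ?_, ?_⟩, List.take_append_drop m w⟩
  · simp [hwn, h]
  · exact (List.take_prefix m w).isInfix
  · simp [hwn, h]
  · exact slidingWindow_of_infix hw (List.drop_suffix m w).isInfix
  · simp [hwn]

theorem capacity_slidingWindow_le {k m : ℕ} (hm : 0 < m) (Γ : Set ((Fin k → A) → ℝ)) {c : ℝ}
    (h : ((slice (admissible Γ) m).ncard : ℝ) ≤ 2 ^ (c * m)) :
    capacity (slidingWindow m Γ) ≤ c := by
  set a : ℕ → ℝ := fun n => (slice (slidingWindow m Γ) n).ncard with ha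
  have ha0 : ∀ n, 0 ≤ a n := fun n => Nat.cast_nonneg _
  -- `D` absorbs the lengths below `m`, from which the induction proceeds in steps of `m`.
  set D : ℝ := 1 + ∑ r ∈ Finset.range m, a r * 2 ^ (-(c * r)) with hD
  have hterm : ∀ r ∈ Finset.range m, 0 ≤ a r * 2 ^ (-(c * r)) :=
    fun r _ => mul_nonneg (ha0 r) (by positivity)
  have hD0 : 0 < D := by
    have := Finset.sum_nonneg hterm
    linarith
  refine capacity_le hD0 fun n => ?_
  change a n ≤ _
  induction n using Nat.strong_induction_on with
  | _ n ih =>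
    rcases lt_or_ge n m with hnm | hnm
    · have := Finset.single_le_sum hterm (Finset.mem_range.2 hnm)
      rw [← div_le_iff₀ (by positivity), div_eq_mul_inv, ← Real.rpow_neg two_pos.le]
      linarith
    · calc a n ≤ 2 ^ (c * m) * a (n - m) := by
            refine le_trans ?_ (mul_le_mul_of_nonneg_right h (ha0 _))
            simp only [ha]
            exact_mod_cast ncard_slice_slidingWindow_le Γ hnm
        _ ≤ 2 ^ (c * m) * (D * 2 ^ (c * ((n - m : ℕ) : ℝ))) :=
            mul_le_mul_of_nonneg_left (ih _ (by omega)) (by positivity)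
        _ = D * 2 ^ (c * n) := by
            rw [mul_left_comm, ← Real.rpow_add two_pos, Nat.cast_sub hnm]
            ring_nf

theorem limsup_capacity_slidingWindow_le {k : ℕ} (Γ : Set ((Fin k → A) → ℝ)) :
    limsup (fun m : ℕ => capacity (slidingWindow m Γ)) atTop ≤ capacity (admissible Γ) := by
  refine EReal.le_of_forall_lt_iff_le.1 fun c hc => limsup_le_of_le (by isBoundedDefault) ?_
  filter_upwards [eventually_ncard_slice_le hc, eventually_gt_atTop 0] with m hm hm0
  exact capacity_slidingWindow_le hm0 Γ hm

/-- The failure of a vector to be shift-invariant. -/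
noncomputable def defect {k : ℕ} (η : (Fin (k + 1) → A) → ℝ) : ℝ :=
  ∑ φ : Fin k → A, |∑ a : A, η (Fin.cons a φ) - ∑ a : A, η (Fin.snoc φ a)|

theorem defect_freq_le {k : ℕ} {w : List A} (h : k < w.length) :
    defect (freq (k + 1) w) ≤ Fintype.card (Fin k → A) * ((w.length : ℝ) - k)⁻¹ := by
  have hpos : 0 < (w.length : ℝ) - k := sub_pos.2 (Nat.cast_lt.2 h)
  have : ∀ φ ∈ (Finset.univ : Finset (Fin k → A)),
      |∑ a : A, freq (k + 1) w (Fin.cons a φ) - ∑ a : A, freq (k + 1) w (Fin.snoc φ a)| ≤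
        ((w.length : ℝ) - k)⁻¹ := by
    intro φ _
    simp only [freq_eq, Pi.smul_apply, smul_eq_mul, ← Finset.mul_sum]
    rw [← mul_sub, abs_mul, abs_of_pos (inv_pos.2 hpos)]
    exact mul_le_of_le_one_right (inv_pos.2 hpos).le (abs_sum_countVec_cons_sub_le φ w)
  refine (Finset.sum_le_sum this).trans ?_
  simp

/-- If long admissible words exist, a closed set of measures has a shift-invariant member. -/
theorem inter_shiftInvariant_nonempty {k : ℕ} {Γ : Set ((Fin (k + 1) → A) → ℝ)}
    (hΓ : Γ ⊆ probMeasures A (k + 1)) (hclosed : IsClosed Γ)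
    (h : ∃ᶠ n : ℕ in atTop, (slice (admissible Γ) n).Nonempty) :
    (Γ ∩ shiftInvariant A k).Nonempty := by
  have hcompact : IsCompact Γ := (isCompact_stdSimplex ℝ _).of_isClosed_subset hclosed hΓ
  have hne : Γ.Nonempty := by
    obtain ⟨n, w, hw⟩ := h.exists
    exact ⟨_, hw.1.2⟩
  have hcont : Continuous (defect : ((Fin (k + 1) → A) → ℝ) → ℝ) := by
    -- The defect attains its minimum on the compact `Γ`, while long admissible words bring it below
    -- any positive value.
    unfold defect
    fun_prop
  obtain ⟨η, hη, hmin⟩ := hcompact.exists_isMinOn hne hcont.continuousOn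
  have hzero : defect η ≤ 0 := by
    by_contra! hpos
    have hlim : Tendsto (fun n : ℕ => Fintype.card (Fin k → A) * ((n : ℝ) - k)⁻¹) atTop (𝓝 0) := by
      have h1 : Tendsto (fun n : ℕ => ((n : ℝ) - k)) atTop atTop :=
        tendsto_atTop_add_const_right _ _ tendsto_natCast_atTop_atTop
      simpa using (tendsto_inv_atTop_zero.comp h1).const_mul (Fintype.card (Fin k → A) : ℝ)
    obtain ⟨n, ⟨w, hw, hwn⟩, hn⟩ := (h.and_eventually (hlim.eventually_lt_const hpos)).exists
    have h1 := defect_freq_le (A := A) (k := k) (w := w) hw.1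
    rw [hwn] at h1
    have h2 : defect η ≤ _ := hmin hw.2
    linarith
  refine ⟨η, hη, hΓ hη, fun φ => ?_⟩
  have h0 : defect η = 0 := le_antisymm hzero (Finset.sum_nonneg fun _ _ => abs_nonneg _)
  rw [defect, Finset.sum_eq_zero_iff_of_nonneg fun _ _ => abs_nonneg _] at h0
  exact sub_eq_zero.1 (abs_eq_zero.1 (h0 φ (Finset.mem_univ φ)))

end Capacity

end Semiconstrained

namespace Semiconstrained

/-! ### Concatenations of blocks of equal length. -/

section Concatenation

variable {A : Type*}

theorem prefix_flatten_decomposition {n : ℕ} {L : List (List A)} (hL : ∀ x ∈ L, x.length = n)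
    {y r : List A} (h : y ++ r = L.flatten) :
    ∃ (L' : List (List A)) (t : List A), y = L'.flatten ++ t ∧ t.length ≤ n ∧ ∀ x ∈ L', x ∈ L := by
  induction L generalizing y with
  | nil =>
    simp only [List.flatten_nil, List.append_eq_nil_iff] at h
    exact ⟨[], [], by simp [h.1], by simp, by simp⟩
  | cons x L ih =>
    rw [List.flatten_cons, List.append_eq_append_iff] at h
    rcases h with ⟨a, hx, -⟩ | ⟨c, hy, hr⟩
    · refine ⟨[], y, by simp, ?_, by simp⟩
      have := hL x (by simp)
      rw [hx, List.length_append] at this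
      omega
    · obtain ⟨L', t, h1, h2, h3⟩ := ih (fun z hz => hL z (by simp [hz])) hr.symm
      refine ⟨x :: L', t, by simp [hy, h1], h2, ?_⟩
      simp only [List.mem_cons, forall_eq_or_imp, true_or, true_and]
      exact fun z hz => Or.inr (h3 z hz)

/-- A subword of a concatenation of blocks is a concatenation of blocks up to short ends. -/
theorem infix_flatten_decomposition {n : ℕ} {L : List (List A)} (hL : ∀ x ∈ L, x.length = n)
    {y : List A} (h : y <:+: L.flatten) :
    ∃ (s : List A) (L' : List (List A)) (t : List A), y = s ++ (L'.flatten ++ t) ∧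
      s.length ≤ n ∧ t.length ≤ n ∧ ∀ x ∈ L', x ∈ L := by
  obtain ⟨p, r, h⟩ := h
  rw [List.append_assoc] at h
  induction L generalizing p with
  | nil =>
    simp only [List.flatten_nil, List.append_eq_nil_iff] at h
    exact ⟨[], [], [], by simp [h.2.1], by simp, by simp, by simp⟩
  | cons x L ih =>
    have hx := hL x (by simp)
    have hL' : ∀ z ∈ L, z.length = n := fun z hz => hL z (by simp [hz])
    rw [List.flatten_cons, List.append_eq_append_iff] at h
    rcases h with ⟨a, hxp, hyr⟩ | ⟨c, -, hc⟩
    · rw [hxp, List.length_append] at hx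
      rw [List.append_eq_append_iff] at hyr
      rcases hyr with ⟨a', ha, -⟩ | ⟨c', hy, hf⟩
      · rw [ha, List.length_append] at hx
        exact ⟨y, [], [], by simp, by omega, by simp, by simp⟩
      · obtain ⟨L', t, h1, h2, h3⟩ := prefix_flatten_decomposition hL' hf.symm
        exact ⟨a, L', t, by rw [hy, h1], by omega, h2, fun z hz => by simp [h3 z hz]⟩
    · obtain ⟨s, L', t, h1, h2, h3, h4⟩ := ih hL' c hc.symm
      exact ⟨s, L', t, h1, h2, h3, fun z hz => by simp [h4 z hz]⟩

/-- The concatenations of `q` words taken from `T`. -/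
def powWords (T : Set (List A)) (q : ℕ) : Set (List A) :=
  {w | ∃ L : List (List A), L.length = q ∧ (∀ x ∈ L, x ∈ T) ∧ w = L.flatten}

theorem length_of_mem_powWords {T : Set (List A)} {n q : ℕ} (hT : ∀ x ∈ T, x.length = n)
    {w : List A} (hw : w ∈ powWords T q) : w.length = q * n := by
  obtain ⟨L, rfl, hL, rfl⟩ := hw
  induction L with
  | nil => simp
  | cons x L ih =>
    simp only [List.mem_cons, forall_eq_or_imp] at hL
    rw [List.flatten_cons, List.length_append, ih hL.2, hT x hL.1, List.length_cons]
    ring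

theorem powWords_succ (T : Set (List A)) (q : ℕ) :
    powWords T (q + 1) = (fun p : List A × List A => p.1 ++ p.2) '' (T ×ˢ powWords T q) := by
  ext w
  constructor
  · rintro ⟨L, hq, hL, rfl⟩
    cases L with
    | nil => simp at hq
    | cons x L =>
      simp only [List.mem_cons, forall_eq_or_imp] at hL
      exact ⟨(x, L.flatten), ⟨hL.1, L, by simpa using hq, hL.2, rfl⟩, rfl⟩
  · rintro ⟨⟨x, _⟩, ⟨hx, L, hq, hL, rfl⟩, rfl⟩
    refine ⟨x :: L, by simpa using hq, ?_, rfl⟩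
    simp only [List.mem_cons, forall_eq_or_imp]
    exact ⟨hx, hL⟩

theorem ncard_powWords {T : Set (List A)} {n : ℕ} (hT : ∀ x ∈ T, x.length = n) (q : ℕ) :
    (powWords T q).ncard = T.ncard ^ q := by
  induction q with
  | zero =>
    have : powWords T 0 = {[]} := by
      ext w
      constructor
      · rintro ⟨L, hq, -, rfl⟩
        rw [List.length_eq_zero_iff] at hq
        simp [hq]
      · rintro rfl
        exact ⟨[], by simp⟩
    simp [this]
  | succ q ih =>
    rw [powWords_succ, Set.InjOn.ncard_image, Set.ncard_prod, ih, pow_succ, mul_comm]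
    rintro ⟨x, y⟩ ⟨hx, -⟩ ⟨x', y'⟩ ⟨hx', -⟩ h
    have := List.append_inj h ((hT x hx).trans (hT x' hx').symm)
    exact Prod.ext this.1 this.2

end Concatenation

/-! ### Words close to a set of measures, and room inside `Γ`. -/

section Near

variable {A : Type*} [Fintype A] {k : ℕ}

/-- The window counts of `w` agree, up to `e`, with those predicted by some measure in `G`. -/
def Near (G : Set ((Fin (k + 1) → A) → ℝ)) (e : ℝ) (w : List A) : Prop :=
  ∃ γ ∈ G, ‖countVec k w - (w.length : ℝ) • γ‖ ≤ e

theorem Near.mono {G : Set ((Fin (k + 1) → A) → ℝ)} {e e' : ℝ} {w : List A} (h : Near G e w)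
    (he : e ≤ e') : Near G e' w := by
  obtain ⟨γ, hγ, hn⟩ := h
  exact ⟨γ, hγ, hn.trans he⟩

/-- Unnormalized errors simply add, with `k` for the junction. Three sets are needed because a
superblock mixes `Γ` with `{η}`. -/
theorem Near.append_of {G₁ G₂ G : Set ((Fin (k + 1) → A) → ℝ)} {e₁ e₂ : ℝ} {u v : List A}
    (hu : Near G₁ e₁ u) (hv : Near G₂ e₂ v)
    (hG : ∀ γ₁ ∈ G₁, ∀ γ₂ ∈ G₂, ∃ γ ∈ G, ((u.length : ℝ) + v.length) • γ =
      (u.length : ℝ) • γ₁ + (v.length : ℝ) • γ₂) :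
    Near G (e₁ + e₂ + k) (u ++ v) := by
  obtain ⟨γ₁, h₁, hu⟩ := hu
  obtain ⟨γ₂, h₂, hv⟩ := hv
  obtain ⟨γ, hγ, heq⟩ := hG γ₁ h₁ γ₂ h₂
  refine ⟨γ, hγ, ?_⟩
  rw [List.length_append, Nat.cast_add, heq]
  have h3 := norm_countVec_append_sub_le (k := k) u v
  calc ‖countVec k (u ++ v) - ((u.length : ℝ) • γ₁ + (v.length : ℝ) • γ₂)‖
      = ‖(countVec k u - (u.length : ℝ) • γ₁) + (countVec k v - (v.length : ℝ) • γ₂) +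
          (countVec k (u ++ v) - (countVec k u + countVec k v))‖ := by congr 1; abel
    _ ≤ e₁ + e₂ + k := (norm_add_le _ _).trans
        (add_le_add ((norm_add_le _ _).trans (add_le_add hu hv)) h3)

theorem Near.append {G : Set ((Fin (k + 1) → A) → ℝ)} (hG : Convex ℝ G) {e₁ e₂ : ℝ}
    {u v : List A} (hu : Near G e₁ u) (hv : Near G e₂ v) :
    Near G (e₁ + e₂ + k) (u ++ v) := by
  refine hu.append_of hv fun γ₁ h₁ γ₂ h₂ => ?_
  have hu0 : (0 : ℝ) ≤ u.length := Nat.cast_nonneg _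
  have hv0 : (0 : ℝ) ≤ v.length := Nat.cast_nonneg _
  exact hG.exists_mem_add_smul_eq h₁ h₂ hu0 hv0

theorem near_flatten {G : Set ((Fin (k + 1) → A) → ℝ)} (hG : Convex ℝ G) (hne : G.Nonempty)
    {e : ℝ} {L : List (List A)} (hL : ∀ x ∈ L, Near G e x) :
    Near G (L.length * (e + k)) L.flatten := by
  induction L with
  | nil =>
    obtain ⟨γ, hγ⟩ := hne
    exact ⟨γ, hγ, by simp [countVec_nil]⟩
  | cons x L ih =>
    simp only [List.mem_cons, forall_eq_or_imp] at hL
    refine (hL.1.append hG (ih hL.2)).mono (le_of_eq ?_)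
    rw [List.length_cons]
    push_cast
    ring

/-- A trivial bound, for the incomplete blocks at the ends of a window. -/
theorem near_length {G : Set ((Fin (k + 1) → A) → ℝ)} (hG : G ⊆ probMeasures A (k + 1))
    (hne : G.Nonempty) (w : List A) : Near G w.length w := by
  obtain ⟨γ, hγ⟩ := hne
  refine ⟨γ, hγ, (pi_norm_le_iff_of_nonneg (Nat.cast_nonneg _)).2 fun φ => ?_⟩
  have h1 : (windowCount φ w : ℝ) ≤ w.length := by exact_mod_cast windowCount_le_length φ w
  have h2 : (0 : ℝ) ≤ windowCount φ w := Nat.cast_nonneg _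
  have h3 : γ φ ≤ 1 := (le_abs_self _).trans
    ((norm_le_pi_norm γ φ).trans (norm_le_one_of_mem_probMeasures (hG hγ)))
  have h4 : (w.length : ℝ) * γ φ ≤ w.length :=
    mul_le_of_le_one_right (Nat.cast_nonneg _) h3
  have h5 : 0 ≤ (w.length : ℝ) * γ φ := mul_nonneg (Nat.cast_nonneg _) ((hG hγ).1 φ)
  rw [Real.norm_eq_abs, abs_le]
  simp only [countVec, Pi.sub_apply, Pi.smul_apply, smul_eq_mul]
  constructor <;> linarith

/-- The error comes from scaling by `|w|` instead of the number `|w| - k` of windows. -/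
theorem near_of_admissible {Γ : Set ((Fin (k + 1) → A) → ℝ)} (hΓ : Γ ⊆ probMeasures A (k + 1))
    {w : List A} (hw : w ∈ admissible Γ) : Near Γ k w := by
  refine ⟨_, hw.2, ?_⟩
  have hlt : (k : ℝ) < w.length := by exact_mod_cast hw.1
  have h1 : ((w.length : ℝ) - k) • freq (k + 1) w = countVec k w := by
    rw [freq_eq, smul_inv_smul₀ (sub_pos.2 hlt).ne']
  have h2 : countVec k w - (w.length : ℝ) • freq (k + 1) w = -((k : ℝ) • freq (k + 1) w) := by
    rw [← h1]
    module
  rw [h2, norm_neg, norm_smul, Real.norm_eq_abs, abs_of_nonneg (Nat.cast_nonneg k)]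
  exact mul_le_of_le_one_right (Nat.cast_nonneg k) (norm_le_one_of_mem_probMeasures (hΓ hw.2))

/-- A set of measures lying deep inside `Γ` forces concatenations of nearby blocks into the
sliding-window system. -/
theorem eventually_flatten_mem_slidingWindow {G Γ : Set ((Fin (k + 1) → A) → ℝ)}
    (hG : G ⊆ probMeasures A (k + 1)) (hconv : Convex ℝ G) (hne : G.Nonempty)
    {n : ℕ} {e ε : ℝ} (he : 0 ≤ e) (hkn : k ≤ e * n) (heε : 4 * e < ε)
    {T : Set (List A)} (hT : ∀ x ∈ T, x.length = n) (hnear : ∀ x ∈ T, Near G (3 * e * n) x)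
    (hroom : ∀ γ ∈ G, ∀ y : (Fin (k + 1) → A) → ℝ, ∑ φ, y φ = 1 → ‖y - γ‖ < ε → y ∈ Γ) :
    ∀ᶠ m : ℕ in atTop, ∀ q, powWords T q ⊆ slidingWindow m Γ := by
  -- Against a budget of `ε (m - k)`, the whole blocks cost `4 e m`, the two ends `2 n`, and two
  -- junctions with the change of normalization `3 k`.
  obtain ⟨M, hM⟩ := exists_nat_gt ((2 * n + 3 * k + ε * k) / (ε - 4 * e))
  filter_upwards [eventually_ge_atTop M, eventually_gt_atTop k] with m hmM hmk
  rintro q w ⟨L, -, hL, rfl⟩ y ⟨hym, hy⟩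
  obtain ⟨s, L', t, hdec, hs, ht, hL'⟩ :=
    infix_flatten_decomposition (fun x hx => hT x (hL x hx)) hy
  have hL'T : ∀ x ∈ L', x ∈ T := fun x hx => hL x (hL' x hx)
  have hlen : L'.length * n ≤ m := by
    have := length_of_mem_powWords hT ⟨L', rfl, hL'T, rfl⟩
    rw [← hym, hdec, List.length_append, List.length_append, this]
    omega
  have h1 := (near_length hG hne s).append hconv
    ((near_flatten hconv hne fun x hx => hnear x (hL'T x hx)).append hconv (near_length hG hne t))
  rw [← hdec] at h1
  obtain ⟨γ, hγ, hyγ⟩ := h1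
  have hs' : (s.length : ℝ) ≤ n := Nat.cast_le.2 hs
  have ht' : (t.length : ℝ) ≤ n := Nat.cast_le.2 ht
  have hlen' : (L'.length : ℝ) * n ≤ m := by exact_mod_cast hlen
  have hL0 : (0 : ℝ) ≤ L'.length := Nat.cast_nonneg _
  have hmk' : (k : ℝ) < m := Nat.cast_lt.2 hmk
  have hmM' : (M : ℝ) ≤ m := Nat.cast_le.2 hmM
  have hbig : 2 * n + 3 * k + ε * k < (ε - 4 * e) * m := by
    rw [← div_lt_iff₀' (sub_pos.2 heε)]
    exact hM.trans_le hmM'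
  have hem : L'.length * (3 * e * n + k) ≤ 4 * e * m := by
    calc L'.length * (3 * e * n + k) ≤ L'.length * (4 * e * n) :=
          mul_le_mul_of_nonneg_left (by linarith) hL0
      _ = 4 * e * (L'.length * n) := by ring
      _ ≤ 4 * e * m := mul_le_mul_of_nonneg_left hlen' (by linarith)
  have hpos : 0 < (m : ℝ) - k := sub_pos.2 hmk'
  refine ⟨by omega, hroom γ hγ _ ?_ ?_⟩
  · rw [freq_eq, hym]
    simp only [Pi.smul_apply, smul_eq_mul, ← Finset.mul_sum]
    rw [sum_countVec y (by omega), hym, inv_mul_cancel₀ hpos.ne']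
  · have h2 : freq (k + 1) y - γ =
        ((m : ℝ) - k)⁻¹ • ((countVec k y - (y.length : ℝ) • γ) + (k : ℝ) • γ) := by
      rw [eq_inv_smul_iff₀ hpos.ne', smul_sub, freq_eq, hym, smul_inv_smul₀ hpos.ne']
      module
    have h3 : ‖(k : ℝ) • γ‖ ≤ k := by
      rw [norm_smul, Real.norm_eq_abs, abs_of_nonneg (Nat.cast_nonneg k)]
      exact mul_le_of_le_one_right (Nat.cast_nonneg k) (norm_le_one_of_mem_probMeasures (hG hγ))
    rw [h2, norm_smul, Real.norm_eq_abs, abs_of_pos (inv_pos.2 hpos), inv_mul_lt_iff₀ hpos]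
    refine (norm_add_le _ _).trans_lt ((add_le_add hyγ h3).trans_lt ?_)
    linarith

/-- A shift-invariant interior point can be moved to have room in all directions of total mass
zero. -/
theorem exists_shiftInvariant_room {Γ : Set ((Fin (k + 1) → A) → ℝ)} {η : (Fin (k + 1) → A) → ℝ}
    (hη : η ∈ shiftInvariant A k) (hΓ : Γ ∈ 𝓝[probMeasures A (k + 1)] η) :
    ∃ η₀ ∈ shiftInvariant A k, ∃ ε > 0, ∀ y : (Fin (k + 1) → A) → ℝ,
      ∑ φ, y φ = 1 → ‖y - η₀‖ < ε → y ∈ Γ := by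
  have := nonempty_of_mem_probMeasures hη.1
  obtain ⟨r, hr, hball⟩ := Metric.mem_nhdsWithin_iff.1 hΓ
  set N : ℝ := (Fintype.card (Fin (k + 1) → A) : ℝ) with hN
  have hN0 : 0 < N := Nat.cast_pos.2 Fintype.card_pos
  set ν : (Fin (k + 1) → A) → ℝ := fun _ => N⁻¹ with hν
  have hνP : ν ∈ probMeasures A (k + 1) := by
    refine ⟨fun _ => (inv_pos.2 hN0).le, ?_⟩
    simp only [hν, Finset.sum_const, Finset.card_univ, nsmul_eq_mul]
    exact mul_inv_cancel₀ hN0.ne'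
  -- Mixing in the uniform measure makes every coordinate at least `t / N`, so nearby vectors of
  -- mass one are nonnegative; `t ≤ r / 4` moves `η` by at most `r / 2`.
  set t : ℝ := min 1 (r / 4) with ht
  have ht0 : 0 < t := lt_min one_pos (by positivity)
  have ht1 : t ≤ 1 := min_le_left _ _
  have htr : t ≤ r / 4 := min_le_right _ _
  have hconvex : Convex ℝ (probMeasures A (k + 1)) := convex_stdSimplex ℝ _
  refine ⟨(1 - t) • η + t • ν,
    ⟨hconvex hη.1 hνP (sub_nonneg.2 ht1) ht0.le (by ring), fun φ => ?_⟩,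
    min (r / 2) (t * N⁻¹), lt_min (by positivity) (by positivity), fun y hy hdist => ?_⟩
  · simp only [Pi.add_apply, Pi.smul_apply, smul_eq_mul, Finset.sum_add_distrib,
      ← Finset.mul_sum, hη.2 φ, hν]
  · obtain ⟨hd1, hd2⟩ := lt_min_iff.1 hdist
    refine hball ⟨?_, fun φ => ?_, hy⟩
    · rw [mem_ball_iff_norm]
      have h1 : y - η = (y - ((1 - t) • η + t • ν)) + t • (ν - η) := by module
      have h2 : ‖t • (ν - η)‖ ≤ t * 2 := by
        rw [norm_smul, Real.norm_eq_abs, abs_of_pos ht0]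
        refine mul_le_mul_of_nonneg_left ((norm_sub_le _ _).trans ?_) ht0.le
        linarith [norm_le_one_of_mem_probMeasures hνP, norm_le_one_of_mem_probMeasures hη.1]
      rw [h1]
      refine (norm_add_le _ _).trans_lt ?_
      linarith
    · have h1 := (norm_le_pi_norm (y - ((1 - t) • η + t • ν)) φ).trans_lt hd2
      rw [Real.norm_eq_abs, abs_lt] at h1
      simp only [Pi.sub_apply, Pi.add_apply, Pi.smul_apply, smul_eq_mul, hν] at h1
      have h2 : 0 ≤ (1 - t) * η φ := mul_nonneg (sub_nonneg.2 ht1) (hη.1.1 φ)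
      linarith [h1.1]

end Near

end Semiconstrained

namespace Semiconstrained

/-! ### Superblocks and the lower bound. -/

section LowerBound

variable {A : Type*} {k : ℕ}

/-- The words made of `r` admissible words of length `n` followed by `n` copies of `u`. -/
def superblocks (Γ : Set ((Fin (k + 1) → A) → ℝ)) (u : List A) (r n : ℕ) : Set (List A) :=
  (fun v => v ++ (List.replicate n u).flatten) '' powWords (slice (admissible Γ) n) r

theorem ncard_superblocks (Γ : Set ((Fin (k + 1) → A) → ℝ)) (u : List A) (r n : ℕ) :
    (superblocks Γ u r n).ncard = (slice (admissible Γ) n).ncard ^ r := by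
  rw [superblocks, Set.ncard_image_of_injective _ (List.append_left_injective _),
    ncard_powWords fun x hx => hx.2]

theorem length_of_mem_superblocks {Γ : Set ((Fin (k + 1) → A) → ℝ)} {u : List A} {r n : ℕ}
    {x : List A} (hx : x ∈ superblocks Γ u r n) : x.length = r * n + n * u.length := by
  obtain ⟨v, hv, rfl⟩ := hx
  rw [List.length_append, length_of_mem_powWords (fun x hx => hx.2) hv]
  simp

variable [Fintype A]

/-- The contraction of `Γ` towards `η` by the ratio `p / (p + 1)`. -/
def contraction (Γ : Set ((Fin (k + 1) → A) → ℝ)) (η : (Fin (k + 1) → A) → ℝ) (p : ℕ) :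
    Set ((Fin (k + 1) → A) → ℝ) :=
  (fun γ => ((p : ℝ) + 1)⁻¹ • ((p : ℝ) • γ + η)) '' Γ

omit [Fintype A] in
theorem convex_contraction {Γ : Set ((Fin (k + 1) → A) → ℝ)} (hΓ : Convex ℝ Γ)
    (η : (Fin (k + 1) → A) → ℝ) (p : ℕ) : Convex ℝ (contraction Γ η p) := by
  rintro _ ⟨γ₁, h₁, rfl⟩ _ ⟨γ₂, h₂, rfl⟩ a b ha hb hab
  refine ⟨a • γ₁ + b • γ₂, hΓ h₁ h₂ ha hb hab, ?_⟩
  obtain rfl : b = 1 - a := by linarith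
  module

theorem contraction_subset {Γ : Set ((Fin (k + 1) → A) → ℝ)} (hΓ : Γ ⊆ probMeasures A (k + 1))
    {η : (Fin (k + 1) → A) → ℝ} (hη : η ∈ probMeasures A (k + 1)) (p : ℕ) :
    contraction Γ η p ⊆ probMeasures A (k + 1) := by
  rintro _ ⟨γ, hγ, rfl⟩
  have hp : (0 : ℝ) < p + 1 := by positivity
  have h := convex_stdSimplex ℝ (Fin (k + 1) → A) (hΓ hγ) hη
    (a := ((p : ℝ) + 1)⁻¹ * p) (b := ((p : ℝ) + 1)⁻¹) (by positivity) (by positivity)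
    (by field_simp)
  rwa [mul_smul, ← smul_add] at h

/-- Solving `y = (p g + z)/(p + 1)` for `z` magnifies the distance by `p + 1`, so `z` is within `ε`
of `η`; convexity then gives `y`. -/
theorem mem_of_near_contraction {Γ : Set ((Fin (k + 1) → A) → ℝ)}
    (hΓ : Γ ⊆ probMeasures A (k + 1)) (hconvex : Convex ℝ Γ) {η : (Fin (k + 1) → A) → ℝ} {ε : ℝ}
    (hroom : ∀ y : (Fin (k + 1) → A) → ℝ, ∑ φ, y φ = 1 → ‖y - η‖ < ε → y ∈ Γ) (p : ℕ)
    {γ y : (Fin (k + 1) → A) → ℝ} (hγ : γ ∈ contraction Γ η p) (hy : ∑ φ, y φ = 1)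
    (hdist : ‖y - γ‖ < ε / (p + 1)) : y ∈ Γ := by
  obtain ⟨g, hg, rfl⟩ := hγ
  have hp : (0 : ℝ) < p + 1 := by positivity
  set z : (Fin (k + 1) → A) → ℝ := ((p : ℝ) + 1) • y - (p : ℝ) • g with hz
  have hzΓ : z ∈ Γ := by
    refine hroom z ?_ ?_
    · simp only [hz, Pi.sub_apply, Pi.smul_apply, smul_eq_mul, Finset.sum_sub_distrib,
        ← Finset.mul_sum, hy, (hΓ hg).2]
      ring
    · have : z - η = ((p : ℝ) + 1) • (y - ((p : ℝ) + 1)⁻¹ • ((p : ℝ) • g + η)) := by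
        rw [smul_sub, smul_inv_smul₀ hp.ne', hz]
        abel
      rw [this, norm_smul, Real.norm_eq_abs, abs_of_pos hp]
      rwa [lt_div_iff₀' hp] at hdist
  have h := hconvex hg hzΓ (a := ((p : ℝ) + 1)⁻¹ * p) (b := ((p : ℝ) + 1)⁻¹) (by positivity)
    (by positivity) (by field_simp)
  rwa [mul_smul, ← smul_add, hz, add_sub_cancel, inv_smul_smul₀ hp.ne'] at h

/-- The admissible words occupy exactly `p` times the length of the copies of `u`, matching the
weights of the contraction. The errors add up to at most `(2p + 3) e |u| n`. -/
theorem near_superblock {Γ : Set ((Fin (k + 1) → A) → ℝ)} (hΓ : Γ ⊆ probMeasures A (k + 1))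
    (hconvex : Convex ℝ Γ) (hne : Γ.Nonempty) {η : (Fin (k + 1) → A) → ℝ} {e : ℝ} (he : 0 ≤ e)
    {u : List A}
    (hu0 : 0 < u.length) (huk : k ≤ e * u.length)
    (hu : ‖countVec k u - (u.length : ℝ) • η‖ ≤ e * u.length) {p n : ℕ} (hn : k ≤ e * n)
    {x : List A} (hx : x ∈ superblocks Γ u (p * u.length) n) :
    Near (contraction Γ η p) (3 * e * ((p + 1) * u.length * n)) x := by
  obtain ⟨_, ⟨L, hL, hLx, rfl⟩, rfl⟩ := hx
  have h1 : Near Γ (L.length * (k + k)) L.flatten :=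
    near_flatten hconvex hne fun x hx => near_of_admissible hΓ (hLx x hx).1
  have h2 : Near {η} ((List.replicate n u).length * (e * u.length + k))
      (List.replicate n u).flatten := by
    refine near_flatten (convex_singleton η) (Set.singleton_nonempty η) fun x hx => ?_
    rw [List.eq_of_mem_replicate hx]
    exact ⟨η, rfl, hu⟩
  have hlen1 : L.flatten.length = p * u.length * n :=
    length_of_mem_powWords (fun x hx => hx.2) ⟨L, hL, hLx, rfl⟩
  have hlen2 : (List.replicate n u).flatten.length = n * u.length := by simp
  have h3 := h1.append_of (G := contraction Γ η p) h2 (by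
    rintro γ hγ _ rfl
    refine ⟨_, ⟨γ, hγ, rfl⟩, ?_⟩
    rw [hlen1, hlen2]
    have hp : (0 : ℝ) < p + 1 := by positivity
    have : ((p * u.length * n : ℕ) : ℝ) + (n * u.length : ℕ) =
        (u.length * n : ℝ) * (p + 1) := by push_cast; ring
    dsimp only
    rw [this, mul_smul, smul_inv_smul₀ hp.ne']
    push_cast
    module)
  refine h3.mono ?_
  rw [hL, List.length_replicate]
  have hU : (1 : ℝ) ≤ u.length := by exact_mod_cast hu0
  have hn0 : (0 : ℝ) ≤ n := Nat.cast_nonneg n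
  have hen : e * n ≤ e * (u.length * n) :=
    mul_le_mul_of_nonneg_left (le_mul_of_one_le_left hn0 hU) he
  have hA : (p * u.length : ℝ) * k ≤ p * u.length * (e * n) :=
    mul_le_mul_of_nonneg_left hn (by positivity)
  have hB : (n : ℝ) * k ≤ n * (e * u.length) := mul_le_mul_of_nonneg_left huk hn0
  have hC : 0 ≤ (p * u.length : ℝ) * (e * n) := by positivity
  push_cast
  linarith

theorem le_limsup_capacity {Γ : Set ((Fin (k + 1) → A) → ℝ)} (hΓ : Γ ⊆ probMeasures A (k + 1))
    (hconvex : Convex ℝ Γ) {η : (Fin (k + 1) → A) → ℝ} (hη : η ∈ shiftInvariant A k)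
    {ε : ℝ} (hε : 0 < ε)
    (hroom : ∀ y : (Fin (k + 1) → A) → ℝ, ∑ φ, y φ = 1 → ‖y - η‖ < ε → y ∈ Γ) {c : ℝ}
    (hc : (c : EReal) < capacity (admissible Γ)) :
    (c : EReal) ≤ limsup (fun m : ℕ => capacity (slidingWindow m Γ)) atTop := by
  obtain ⟨c', hcc', hc'⟩ := EReal.lt_iff_exists_real_btwn.1 hc
  rw [EReal.coe_lt_coe_iff] at hcc'
  set d : ℝ := max c' 0 with hd
  have hcd : c < d := hcc'.trans_le (le_max_left _ _)
  have hd0 : 0 ≤ d := le_max_right _ _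
  -- Only the fraction `p / (p + 1)` of a superblock carries free choices, and the rate `d * p / (p
  -- + 1)` must still reach `c`.
  obtain ⟨p, hp⟩ : ∃ p : ℕ, c * (p + 1) ≤ d * p := by
    obtain ⟨p, hp⟩ := exists_nat_ge (c / (d - c))
    refine ⟨p, ?_⟩
    rw [div_le_iff₀ (sub_pos.2 hcd)] at hp
    linarith
  have hp1 : (0 : ℝ) < p + 1 := by positivity
  -- Then `4 * e` is half of the room `ε / (p + 1)` around the contraction.
  set e : ℝ := ε / (p + 1) / 8 with he
  have he0 : 0 < e := by positivity
  obtain ⟨u, hu0, huk, hu⟩ := exists_word_near hη he0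
  obtain ⟨M, hM⟩ := exists_nat_ge (k / e)
  obtain ⟨n, hbn, hn⟩ := ((frequently_lt_ncard_slice hc').and_eventually
    (eventually_ge_atTop (M + 1))).exists
  have hn0 : 0 < n := by omega
  have hkn : k ≤ e * n := by
    have : (M : ℝ) ≤ n := Nat.cast_le.2 (by omega)
    rw [div_le_iff₀' he0] at hM
    exact hM.trans (mul_le_mul_of_nonneg_left this he0.le)
  set b : ℕ := (slice (admissible Γ) n).ncard with hb
  have hb1 : (1 : ℝ) ≤ b := by
    have : (0 : ℝ) < b := lt_trans (by positivity) hbn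
    exact_mod_cast this
  have hbd : (2 : ℝ) ^ (d * n) ≤ b := by
    rcases le_total c' 0 with h | h
    · rwa [hd, max_eq_right h, zero_mul, Real.rpow_zero]
    · rw [hd, max_eq_left h]
      exact hbn.le
  have hne : Γ.Nonempty := ⟨η, hroom η hη.1.2 (by simpa using hε)⟩
  set n' : ℕ := (p + 1) * u.length * n with hn'
  have hn'cast : (n' : ℝ) = (p + 1) * u.length * n := by rw [hn']; push_cast; ring
  have hn'0 : 0 < n' := by positivity
  have hnn' : n ≤ n' := Nat.le_mul_of_pos_left n (by positivity)
  set T := superblocks Γ u (p * u.length) n with hT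
  have hTlen : ∀ x ∈ T, x.length = n' := by
    intro x hx
    rw [length_of_mem_superblocks hx, hn']
    ring
  have hev := eventually_flatten_mem_slidingWindow (Γ := Γ) (G := contraction Γ η p) (n := n')
    (e := e) (ε := ε / (p + 1)) (T := T)
    (contraction_subset hΓ hη.1 p) (convex_contraction hconvex η p) (hne.image _) he0.le
    (hkn.trans (mul_le_mul_of_nonneg_left (Nat.cast_le.2 hnn') he0.le))
    (by have : 0 < ε / (p + 1) := by positivity
        linarith) hTlen
    (fun x hx => by
      rw [hn'cast]
      exact near_superblock hΓ hconvex hne he0.le hu0 huk hu hkn hx)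
    (fun γ hγ y hy hdist => mem_of_near_contraction hΓ hconvex hroom p hγ hy hdist)
  refine le_limsup_of_frequently_le' (hev.mono fun m hm => le_capacity ?_).frequently
  have htend : Tendsto (fun q : ℕ => q * n') atTop atTop :=
    tendsto_id.atTop_mul_const' hn'0
  refine htend.frequently (Frequently.of_forall fun q => ?_)
  have hsub : powWords T q ⊆ slice (slidingWindow m Γ) (q * n') :=
    fun w hw => ⟨hm q hw, length_of_mem_powWords hTlen hw⟩
  have hcard := Set.ncard_le_ncard hsub (finite_slice _ _)
  rw [ncard_powWords hTlen, hT, ncard_superblocks, ← hb, ← pow_mul] at hcard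
  calc (2 : ℝ) ^ (c * ((q * n' : ℕ) : ℝ)) ≤ 2 ^ (d * n * ((p * u.length * q : ℕ) : ℝ)) := by
        refine Real.rpow_le_rpow_of_exponent_le one_le_two ?_
        have := mul_le_mul_of_nonneg_right hp (by positivity : (0 : ℝ) ≤ u.length * n * q)
        push_cast
        rw [hn'cast]
        linarith
    _ = ((2 : ℝ) ^ (d * n)) ^ (p * u.length * q) := by rw [Real.rpow_mul_natCast two_pos.le]
    _ ≤ (b : ℝ) ^ (p * u.length * q) := pow_le_pow_left₀ (by positivity) hbd _
    _ ≤ _ := by exact_mod_cast hcard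

end LowerBound

end Semiconstrained

theorem mainTheorem2 {A : Type*} [Fintype A] (k : ℕ) (Γ : Set ((Fin (k + 1) → A) → ℝ))
    (hΓ : Γ ⊆ Semiconstrained.probMeasures A (k + 1))
    (hclosed : IsClosed Γ) (hconvex : Convex ℝ Γ) (hfat : Semiconstrained.IsFat Γ)
    (hint : (Γ ∩ Semiconstrained.shiftInvariant A k).Nonempty →
      ∃ η ∈ Semiconstrained.shiftInvariant A k,
        Γ ∈ 𝓝[Semiconstrained.probMeasures A (k + 1)] η) :
    limsup (fun m : ℕ => Semiconstrained.capacity (Semiconstrained.slidingWindow m Γ)) atTop =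
      Semiconstrained.capacity (Semiconstrained.admissible Γ) := by
  refine le_antisymm (Semiconstrained.limsup_capacity_slidingWindow_le Γ)
    (EReal.ge_of_forall_gt_iff_ge.1 fun c hc => ?_)
  -- A real `c` below the capacity forces admissible words of infinitely many lengths; at capacity
  -- `⊥` there is no such `c`.
  have hlong : ∃ᶠ n : ℕ in atTop,
      (Semiconstrained.slice (Semiconstrained.admissible Γ) n).Nonempty := by
    refine (Semiconstrained.frequently_lt_ncard_slice hc).mono fun n hn => ?_
    refine Set.nonempty_of_ncard_ne_zero fun h0 => ?_
    rw [h0, Nat.cast_zero] at hn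
    exact absurd hn (not_lt.2 (by positivity))
  obtain ⟨η, hη, hnhds⟩ := hint (Semiconstrained.inter_shiftInvariant_nonempty hΓ hclosed hlong)
  obtain ⟨η₀, hη₀, ε, hε, hroom⟩ := Semiconstrained.exists_shiftInvariant_room hη hnhds
  exact Semiconstrained.le_limsup_capacity hΓ hconvex hη₀ hε hroom hc
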